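/- **Setting.** $L\ge 1$ transmitters know a library of $N\ge1$ files $W_1,\dots,W_N$ of $F$ bits each and serve $K$ users. In time slot $t$ the transmitters send $\mathbf s(t)\in\mathbb F_q^L$, $q=2^m$, and user $k$ receives $\mathbf h_k\cdot\mathbf s(t)$, where $\mathbf h_k$ is the $k$-th row of a transfer matrix $\mathbf H\in\mathbb F_q^{K\times L}$ with independent uniform entries; $m$ bits are represented by one symbol. Let $0\le M\le N$ with $MF/N$ an integer. For $1\le\alpha\le K$ put $t_\alpha=\min(\alpha+L-1,K)$ and $b_\alpha=\binom{K-\alpha}{t_\alpha-\alpha}$. *Placement.* Each user caches, independently for all users and files, a uniformly random set of $MF/N$ bits of each file. *Delivery for demands $\mathbf d=(d_1,\dots,d_K)\in[N]^K$.* For $S\subseteq[K]$ let $W_{d_r,S}$ consist of the bits of $W_{d_r}$ cached exactly by the users in $S$. For $r\in U$, $|U|=\alpha$, the subfile $W_{d_r,U\setminus\{r\}}$ is split into $b_\alpha$ mini-files of $\lceil |W_{d_r,U\setminus\{r\}}|/b_\alpha\rceil$ bits (after zero-padding), one for each $\tau\supseteq U$ with $|\tau|=t_\alpha$. For $\alpha=K,\dots,1$,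 for all $\tau\subseteq[K]$ with $|\tau|=t_\alpha$ and for $\omega=1,\dots,\binom{t_\alpha-1}{\alpha-1}$, the transmitters send $\sum_{U\subseteq\tau,\,|U|=\alpha}G_\omega(U)\,\boldsymbol\psi^{\tau\setminus U}$, symbol by symbol. Here $G_\omega(U)$ is a linear combination of the mini-files of $W_{d_r,U\setminus\{r\}}$, $r\in U$, for $\tau$, with fresh independent uniform coefficients in $\mathbb F_q$, all mini-files being zero-padded to the length of the longest mini-file (in whole symbols) occurring in the transmission to $\tau$. The vectors $\boldsymbol\psi^{\tau\setminus U}\in\mathbb F_q^L$ are chosen such that $\mathbf h_i\cdot\boldsymbol\psi^{\tau\setminus U}=0$ for $i\in\tau\setminus U$ and $\ne0$ for $i\in U$. Let $T_C(\mathbf d)$ be the number of time slots used and $T_C=\max_{\mathbf d}T_C(\mathbf d)$ the coding delay. For given demands, let $$X_{\alpha,\tau}=X_{\alpha,\tau}(\mathbf d)=\max_{r\in U\subseteq\tau,\ |U|=\alpha} b_\alpha\left\lceil \tfrac1m\left\lceil \tfrac{|W_{d_r,U\setminus\{r\}}|}{b_\alpha}\right\rceil\right\rceil ,$$ a random variable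 depending on the random placement: the length, in symbols, of the longest subfile involved in the transmissions to $\tau$, each zero-padded so as to split into $b_\alpha$ mini-files of whole symbols. **Theorem.** There is a constant $C$ depending only on $K$ and $L$ such that the following holds for all $N,F,M,m$ as above. 1. With probability at least $1-C/q$ over $\mathbf H$ and the coefficients, vectors $\boldsymbol\psi$ as required exist, and for every such choice of them, every outcome of the placement and all demands, every user recovers its requested file from its cache and its received symbols. 2. For every outcome of the placement and all demands $\mathbf d$, $$T_C(\mathbf d)=\sum_{\alpha=1}^{K}\ \sum_{\tau\subseteq[K],\,|\tau|=\min(\alpha+L-1,K)}\frac{\binom{\min(\alpha+L-1,K)-1}{\alpha-1}}{\binom{K-\alpha}{\min(\alpha+L-1,K)-\alpha}}\,X_{\alpha,\tau}(\mathbf d),$$ and the coding delay $T_C$ is given by the same formula, with $X_{\alpha,\tau}=X_{\alpha,\tau}(\mathbf d^*)$ for worst-case demands $\mathbf d^*$ (depending on the placement). 3. For all $1\le\alpha\le K$, $\tau\subseteq[K]$ with $|\tau|=t_\alpha$, and $\mathbf d$: with $B_{\alpha,\tau}=\max_{r\in U\subseteq\tau,|U|=\alpha}|W_{d_r,U\setminus\{r\}}|$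 one has $B_{\alpha,\tau}\le m\,X_{\alpha,\tau}<B_{\alpha,\tau}+m\,b_\alpha$. -/

import Mathlib

open scoped Matrix

namespace CodedCaching

/-- A library of `N` files of `F` bits each. -/
abbrev Library (N F : ℕ) := Fin N → Fin F → Bool

/-- A placement: for each user `k` and file `n`, the set of the `s` bits of file `n` that user `k`
caches. The uniform law on this type is exactly the decentralized random placement: all the sets
`cached k n` are independent and uniform among the `s`-element sets of bits. -/
@[ext]
structure Placement (K N F s : ℕ) where
  cached : Fin K → Fin N → Finset (Fin F)
  card_cached : ∀ k n, (cached k n).card = s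

instance (K N F s : ℕ) : MeasurableSpace (Placement K N F s) := ⊤

/-- The size `min (α + L - 1) K` of the sets of users that are served jointly. -/
def groupSize (K L α : ℕ) : ℕ := min (α + L - 1) K

/-- The number of mini-files into which a subfile is divided: one for every set of users of size
`groupSize K L α` containing a given set of size `α`. -/
def numPieces (K L α : ℕ) : ℕ := (K - α).choose (groupSize K L α - α)

/-- The number of transmitted vectors for every jointly served set of users. -/
def numReps (K L α : ℕ) : ℕ := (groupSize K L α - 1).choose (α - 1)

/-- The random objects of the delivery phase: the transfer matrix of the linear network, and the
coefficients of the random linear combinations. The coefficient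
`coeff i T ω U r` multiplies the mini-file for user `r` in the `ω`-th linear combination for `U`
within the transmission to `T`, where `U` has `i + 1` elements. Under the uniform law on this type
all entries and coefficients are independent and uniform in the field. -/
@[ext]
structure DeliveryRandomness (K L : ℕ) (𝔽 : Type*) where
  channel : Matrix (Fin K) (Fin L) 𝔽
  coeff : (i : Fin K) → Finset (Fin K) → Fin (numReps K L ((i : ℕ) + 1)) → Finset (Fin K) → Fin K → 𝔽

instance (K L : ℕ) (𝔽 : Type*) : MeasurableSpace (DeliveryRandomness K L 𝔽) := ⊤

section Scheme

variable {K N F s : ℕ}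

/-- The bits of the file requested by user `r` that are cached exactly by the users in `S`. -/
def subfile (p : Placement K N F s) (d : Fin K → Fin N) (r : Fin K) (S : Finset (Fin K)) :
    Finset (Fin F) :=
  Finset.univ.filter fun x => ∀ k, x ∈ p.cached k (d r) ↔ k ∈ S

/-- What user `k` has in its cache: the values of the cached bits, nothing for the others. -/
def cacheContent (p : Placement K N F s) (W : Library N F) (k : Fin K) :
    Fin N → Fin F → Option Bool :=
  fun n x => if x ∈ p.cached k n then some (W n x) else none

/-- The size in bits of the largest subfile involved in the transmissions to `τ`. -/
def largestSubfile (p : Placement K N F s) (d : Fin K → Fin N) (α : ℕ) (τ : Finset (Fin K)) : ℕ :=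
  (τ.powersetCard α).sup fun U => U.sup fun r => (subfile p d r (U.erase r)).card

/-- The number of bits of each mini-file of the subfile of user `r` for `U`. -/
def pieceBits (L : ℕ) (p : Placement K N F s) (d : Fin K → Fin N) (U : Finset (Fin K))
    (r : Fin K) : ℕ :=
  (subfile p d r (U.erase r)).card ⌈/⌉ numPieces K L U.card

/-- The random variable `X α τ`: the largest length, in `m`-bit symbols, of the subfiles involved
in the transmissions to `τ`, each zero-padded so as to split into `numPieces` mini-files
consisting of a whole number of symbols. -/
def X (L m : ℕ) (p : Placement K N F s) (d : Fin K → Fin N) (α : ℕ) (τ : Finset (Fin K)) : ℕ :=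
  (τ.powersetCard α).sup fun U => U.sup fun r =>
    numPieces K L α * (pieceBits L p d U r ⌈/⌉ m)

/-- The length in symbols of a vector transmitted to `T`: all the mini-files in it are zero-padded
to the length of the longest one. -/
def blockLength (L m : ℕ) (p : Placement K N F s) (d : Fin K → Fin N) (α : ℕ)
    (T : Finset (Fin K)) : ℕ :=
  (T.powersetCard α).sup fun U => U.sup fun r => pieceBits L p d U r ⌈/⌉ m

/-- The jointly served sets of users, in the order in which they are processed. -/
noncomputable def groups (K L α : ℕ) : List (Finset (Fin K)) :=
  ((Finset.univ : Finset (Fin K)).powersetCard (groupSize K L α)).toList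

/-- The number of the mini-file that is used for `U` when `T ⊇ U` is processed: how many sets
containing `U` have been processed before, so that every `T ⊇ U` gets a fresh mini-file. -/
noncomputable def pieceIndex (L : ℕ) (U T : Finset (Fin K)) : ℕ :=
  ((groups K L U.card).filter fun T' => U ⊆ T').idxOf T

/-- The bits of the mini-file for user `r ∈ U` in the transmission to `T ⊇ U`: a segment of the
bits of the subfile that are cached exactly by the users in `U` other than `r`. -/
noncomputable def miniFile (L : ℕ) (p : Placement K N F s) (d : Fin K → Fin N) (W : Library N F)
    (T U : Finset (Fin K)) (r : Fin K) : List Bool :=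
  ((((subfile p d r (U.erase r)).sort (· ≤ ·)).map (W (d r))).drop
    (pieceIndex L U T * pieceBits L p d U r)).take (pieceBits L p d U r)

variable {L m : ℕ} {𝔽 : Type*}

/-- The `j`-th field symbol of a bit string, continued by zero bits. -/
def symbol (e : (Fin m → Bool) ≃ 𝔽) (b : List Bool) (j : ℕ) : 𝔽 :=
  e fun i => b.getD (j * m + i) false

variable [Field 𝔽]

/-- The beamforming vectors `ψ`, indexed by the set `T \ U` of unintended users: the vector used
for `U ⊆ T` is nulled at the users of `T` outside `U` and is received by the users in `U`. -/
def IsBeamformer (H : Matrix (Fin K) (Fin L) 𝔽) (ψ : Finset (Fin K) → Fin L → 𝔽) : Prop :=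
  ∀ α ∈ Finset.Icc 1 K, ∀ T : Finset (Fin K), T.card = groupSize K L α →
    ∀ U ⊆ T, U.card = α →
      (∀ i ∈ T \ U, H i ⬝ᵥ ψ (T \ U) = 0) ∧ ∀ i ∈ U, H i ⬝ᵥ ψ (T \ U) ≠ 0

/-- The delivery phase: the vectors sent by the `L` transmitters, one for each time slot, in
order. For `α = K, …, 1` (here `α = i + 1`), for every set `T` of `groupSize K L α` users and every
`ω`, the vector `∑ U, G ω U * ψ (T \ U)` is sent, symbol by symbol. -/
noncomputable def transmissions (e : (Fin m → Bool) ≃ 𝔽) (p : Placement K N F s)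
    (d : Fin K → Fin N) (R : DeliveryRandomness K L 𝔽) (ψ : Finset (Fin K) → Fin L → 𝔽)
    (W : Library N F) : List (Fin L → 𝔽) :=
  (List.finRange K).reverse.flatMap fun i : Fin K =>
    (groups K L ((i : ℕ) + 1)).flatMap fun T =>
      (List.finRange (numReps K L ((i : ℕ) + 1))).flatMap fun ω =>
        (List.range (blockLength L m p d ((i : ℕ) + 1) T)).map fun j =>
          ∑ U ∈ T.powersetCard ((i : ℕ) + 1),
            (∑ r ∈ U, R.coeff i T ω U r * symbol e (miniFile L p d W T U r) j) • ψ (T \ U)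

/-- User `k` can recover the file it requested, whatever the library is, from the symbols that it
receives over the network and its cache content (the placement, the demands, the
transfer matrix, the coefficients and the beamforming vectors being known). -/
def Decodes (e : (Fin m → Bool) ≃ 𝔽) (p : Placement K N F s) (d : Fin K → Fin N)
    (R : DeliveryRandomness K L 𝔽) (ψ : Finset (Fin K) → Fin L → 𝔽) (k : Fin K) : Prop :=
  ∃ dec : List 𝔽 → (Fin N → Fin F → Option Bool) → (Fin F → Bool), ∀ W : Library N F,
    dec ((transmissions e p d R ψ W).map fun v => (R.channel *ᵥ v) k) (cacheContent p W k) =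
      W (d k)

/-- The number of time slots used for the demands `d`. -/
noncomputable def deliveryTime (e : (Fin m → Bool) ≃ 𝔽) (p : Placement K N F s)
    (d : Fin K → Fin N) (R : DeliveryRandomness K L 𝔽) (ψ : Finset (Fin K) → Fin L → 𝔽)
    (W : Library N F) : ℕ :=
  (transmissions e p d R ψ W).length

/-- The coding delay: the number of time slots used for the worst demands. -/
noncomputable def codingDelay (e : (Fin m → Bool) ≃ 𝔽) (p : Placement K N F s)
    (R : DeliveryRandomness K L 𝔽) (ψ : Finset (Fin K) → Fin L → 𝔽) (W : Library N F) : ℕ :=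
  (Finset.univ : Finset (Fin K → Fin N)).sup fun d => deliveryTime e p d R ψ W

end Scheme

end CodedCaching

/-! Everything probabilistic is packed into `IsGeneric`: finitely many determinants, in number and
size bounded in terms of `K` and `L`, are nonzero. Each is a determinant in distinct independent
uniform entries, so by Schwartz–Zippel it vanishes with probability at most its size over `q`; a
union bound gives `C`.

The rest is deterministic. A beamformer for `T \ U` has at most `L - 1` zeros to satisfy. Nonzero
minors of the channel make it possible to be nonzero at any one other user, and fewer than `q`
nonzero linear forms have a common non-root (`IsGeneric.exists_isBeamformer`).

For decoding, fix `T`, a user `k ∈ T` and a symbol position. Sets `U` without `k` are nulled at `k`;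
for `U` containing `k`, the mini-files meant for others are in the cache of `k`. What remains is one
unknown per `U` with `k ∈ U ⊆ T`, hence `numReps` unknowns and as many equations, one per `ω`. The
matrix is a generic coefficient matrix with columns scaled by the nonzero gains `h_k · ψ`
(`symbol_eq_of_received_eq`). Letting `T` run over all groups containing `U` yields all mini-files
of a subfile (`eq_of_symbol_miniFile_eq`).

The delay is the length of an explicit list, and the bounds on `X` come from merging two nested
ceilings into one. -/

namespace CodedCaching

/-! ### Random minors and the union bound -/

section Probability

open MvPolynomial in
theorem totalDegree_det_mvPolynomialX_le (n : ℕ) (R : Type*) [CommRing R] [Nontrivial R] :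
    (Matrix.mvPolynomialX (Fin n) (Fin n) R).det.totalDegree ≤ n := by
  rw [Matrix.det_apply]
  refine totalDegree_finsetSum_le fun σ _ => ?_
  refine (totalDegree_smul_le _ _).trans ?_
  refine (totalDegree_finsetProd _ _).trans ?_
  simp [Matrix.mvPolynomialX]

open MvPolynomial in
/-- A square matrix with independent uniform entries in a finite field is rarely singular. -/
theorem card_filter_det_eq_zero_div_le {σ 𝔽 : Type*} [Fintype σ] [DecidableEq σ] [Field 𝔽]
    [Fintype 𝔽] [DecidableEq 𝔽] {n : ℕ} (g : Fin n → Fin n → σ)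
    (hg : Function.Injective fun x : Fin n × Fin n => g x.1 x.2) :
    ((Finset.univ.filter fun f : σ → 𝔽 =>
        (Matrix.of fun a b => f (g a b)).det = 0).card : ℝ) / Fintype.card (σ → 𝔽) ≤
      n / Fintype.card 𝔽 := by
  let φ := Fintype.equivFin σ
  let P : MvPolynomial (Fin (Fintype.card σ)) 𝔽 :=
    rename (fun x : Fin n × Fin n => φ (g x.1 x.2)) (Matrix.mvPolynomialX (Fin n) (Fin n) 𝔽).det
  have hP : P ≠ 0 := fun h => Matrix.det_mvPolynomialX_ne_zero (Fin n) 𝔽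
    (rename_injective _ (φ.injective.comp hg) (h.trans (map_zero _).symm))
  have hdeg : P.totalDegree ≤ n :=
    (totalDegree_rename_le _ _).trans (totalDegree_det_mvPolynomialX_le n 𝔽)
  have heval (f : Fin (Fintype.card σ) → 𝔽) :
      eval f P = (Matrix.of fun a b => f (φ (g a b))).det := by
    simp only [P, eval_rename, RingHom.map_det]
    congr 1
    ext a b
    simp [Matrix.mvPolynomialX]
  have hcard : (Finset.univ.filter fun f : σ → 𝔽 =>
        (Matrix.of fun a b => f (g a b)).det = 0).card =
      (Finset.filter (fun f => eval f P = 0)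
        (Fintype.piFinset fun _ : Fin (Fintype.card σ) => (Finset.univ : Finset 𝔽))).card := by
    refine Finset.card_equiv (φ.arrowCongr (Equiv.refl 𝔽)) fun f => ?_
    simp [heval, Equiv.arrowCongr]
  have key := schwartz_zippel_totalDegree hP (Finset.univ : Finset 𝔽)
  have key' : ((Finset.filter (fun f => eval f P = 0) (Fintype.piFinset fun _ :
      Fin (Fintype.card σ) => (Finset.univ : Finset 𝔽))).card : ℝ) /
        (Fintype.card 𝔽) ^ (Fintype.card σ) ≤ P.totalDegree / Fintype.card 𝔽 := by
    have := NNRat.cast_le (K := ℝ) |>.2 key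
    push_cast [Finset.card_univ] at this
    exact this
  rw [hcard, Fintype.card_fun]
  push_cast
  refine key'.trans ?_
  gcongr

variable (K L : ℕ) (𝔽 : Type*)

/-- The positions of the entries of a `DeliveryRandomness`. -/
abbrev EntryIndex : Type :=
  Fin K × Fin L ⊕
    Σ i : Fin K, Finset (Fin K) × Fin (numReps K L ((i : ℕ) + 1)) × Finset (Fin K) × Fin K

variable {K L 𝔽}

/-- The delivery randomness as a family of independent entries. -/
def deliveryRandomnessEquiv : DeliveryRandomness K L 𝔽 ≃ (EntryIndex K L → 𝔽) where
  toFun R := Sum.elim (fun x => R.channel x.1 x.2)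
    fun x => R.coeff x.1 x.2.1 x.2.2.1 x.2.2.2.1 x.2.2.2.2
  invFun f := ⟨fun k l => f (.inl (k, l)), fun i T ω U r => f (.inr ⟨i, T, ω, U, r⟩)⟩
  left_inv R := rfl
  right_inv f := by ext (x | x) <;> rfl

instance [Finite 𝔽] : Finite (DeliveryRandomness K L 𝔽) :=
  Finite.of_equiv _ deliveryRandomnessEquiv.symm

/-- Minors of the transfer matrix, and matrices of coefficients that occur in decoding. -/
abbrev MinorIndex (K L : ℕ) : Type :=
  (Σ j : Fin (L + 1), Fin (j : ℕ) ↪ Fin K) ⊕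
    Σ i : Fin K, Finset (Fin K) × Fin K × (Fin (numReps K L ((i : ℕ) + 1)) ↪ Finset (Fin K))

/-- The size of a minor. -/
def MinorIndex.size : MinorIndex K L → ℕ
  | .inl x => x.1
  | .inr x => numReps K L ((x.1 : ℕ) + 1)

/-- The positions of the entries of a minor. -/
def MinorIndex.entry : (x : MinorIndex K L) → Fin x.size → Fin x.size → EntryIndex K L
  | .inl x => fun a b => .inl (x.2 a, Fin.castLE (Nat.lt_succ_iff.1 x.1.2) b)
  | .inr x => fun a b => .inr ⟨x.1, x.2.1, a, x.2.2.2 b, x.2.2.1⟩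

/-- Distinct positions of a minor use distinct random entries, so its determinant is a renamed
generic determinant, a nonzero polynomial. -/
theorem MinorIndex.entry_injective (x : MinorIndex K L) :
    Function.Injective fun y : Fin x.size × Fin x.size => x.entry y.1 y.2 := by
  rintro ⟨a, b⟩ ⟨a', b'⟩ h
  rcases x with x | x
  · simp only [entry, Sum.inl.injEq, Prod.mk.injEq] at h
    exact Prod.ext (x.2.injective h.1) (Fin.castLE_injective _ h.2)
  · simp only [entry, Sum.inr.injEq, Sigma.mk.injEq, heq_eq_eq, true_and, Prod.mk.injEq] at h
    have h1 := congrArg Prod.fst h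
    exact Prod.ext h1 (x.2.2.2.injective (congrArg (fun y => y.2.1) h))

variable [Field 𝔽]

/-- All the minors that occur in the delivery phase are nonzero. -/
def IsGeneric (R : DeliveryRandomness K L 𝔽) : Prop :=
  ∀ x : MinorIndex K L, (Matrix.of fun a b => deliveryRandomnessEquiv R (x.entry a b)).det ≠ 0

theorem IsGeneric.channel_det_ne_zero {R : DeliveryRandomness K L 𝔽} (hR : IsGeneric R) {j : ℕ}
    (hj : j ≤ L) (ρ : Fin j ↪ Fin K) :
    (Matrix.of fun a b => R.channel (ρ a) (Fin.castLE hj b)).det ≠ 0 :=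
  hR (.inl ⟨⟨j, Nat.lt_succ_of_le hj⟩, ρ⟩)

theorem IsGeneric.coeff_det_ne_zero {R : DeliveryRandomness K L 𝔽} (hR : IsGeneric R) (i : Fin K)
    (T : Finset (Fin K)) (k : Fin K)
    (ε : Fin (numReps K L ((i : ℕ) + 1)) ↪ Finset (Fin K)) :
    (Matrix.of fun a b => R.coeff i T a (ε b) k).det ≠ 0 :=
  hR (.inr ⟨i, T, k, ε⟩)

open MeasureTheory ProbabilityTheory

instance [Finite 𝔽] : IsProbabilityMeasure
    (uniformOn (Set.univ : Set (DeliveryRandomness K L 𝔽))) :=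
  isProbabilityMeasure_uniformOn Set.finite_univ
    ⟨deliveryRandomnessEquiv.symm fun _ => 0, Set.mem_univ _⟩

theorem uniformOn_real_det_eq_zero_le [Fintype 𝔽] (x : MinorIndex K L) :
    (uniformOn (Set.univ : Set (DeliveryRandomness K L 𝔽))).real
      {R | (Matrix.of fun a b => deliveryRandomnessEquiv R (x.entry a b)).det = 0} ≤
        x.size / Fintype.card 𝔽 := by
  classical
  have : Fintype (DeliveryRandomness K L 𝔽) := Fintype.ofFinite _
  have : Fintype (EntryIndex K L) := inferInstance
  have : DecidableEq (EntryIndex K L) := inferInstance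
  refine le_trans (le_of_eq ?_)
    (card_filter_det_eq_zero_div_le (𝔽 := 𝔽) x.entry x.entry_injective)
  rw [measureReal_def, uniformOn_univ, ENNReal.toReal_div, ENNReal.toReal_natCast]
  refine congrArg₂ (· / ·) ?_ (congrArg Nat.cast (Fintype.card_congr deliveryRandomnessEquiv))
  rw [← Set.coe_toFinset {R : DeliveryRandomness K L 𝔽 | _}, Measure.count_apply_finset' MeasurableSpace.measurableSet_top,
    ENNReal.toReal_natCast, Nat.cast_inj]
  refine Finset.card_equiv deliveryRandomnessEquiv fun R => ?_
  simp

/-- Union bound over all minors; the index type depends on `K` and `L` only. -/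
theorem one_sub_le_uniformOn_real_isGeneric [Fintype 𝔽] :
    1 - (∑ x : MinorIndex K L, (x.size : ℝ)) / Fintype.card 𝔽 ≤
      (uniformOn (Set.univ : Set (DeliveryRandomness K L 𝔽))).real {R | IsGeneric R} := by
  have hset : {R : DeliveryRandomness K L 𝔽 | IsGeneric R} =
      (⋃ x : MinorIndex K L, {R | (Matrix.of fun a b =>
        deliveryRandomnessEquiv R (x.entry a b)).det = 0})ᶜ := by
    ext R
    simp [IsGeneric]
  rw [hset, probReal_compl_eq_one_sub MeasurableSpace.measurableSet_top, Finset.sum_div]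
  gcongr
  exact (measureReal_iUnion_fintype_le _).trans
    (Finset.sum_le_sum fun x _ => uniformOn_real_det_eq_zero_le x)

end Probability

/-! ### Existence of beamforming vectors -/

section Beamforming

/-- Finitely many nonzero linear forms have a common non-root if the field is large. -/
theorem exists_forall_linearMap_ne_zero {ι k E : Type*} [Field k] [Fintype k] [AddCommGroup E]
    [Module k E] (f : ι → E →ₗ[k] k) (s : Finset ι) (hs : s.card < Fintype.card k)
    (hf : ∀ i ∈ s, f i ≠ 0) : ∃ v, ∀ i ∈ s, f i v ≠ 0 := by
  classical
  induction s using Finset.induction_on with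
  | empty => exact ⟨0, by simp⟩
  | insert a s ha ih =>
    rw [Finset.card_insert_of_notMem ha] at hs
    obtain ⟨v, hv⟩ := ih (by omega) fun i hi => hf i (Finset.mem_insert_of_mem hi)
    obtain ⟨w, hw⟩ : ∃ w, f a w ≠ 0 := by
      by_contra! h
      exact hf a (Finset.mem_insert_self _ _) (LinearMap.ext h)
    by_cases hav : f a v = 0
    -- Move along the line `v + z • w`: `z ≠ 0` repairs the form `f a`, and each old form excludes
    -- at most one `z`. If `f i w = 0`, the listed quotient is `0` by convention, and `f i` stays
    -- nonzero along the whole line.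
    · obtain ⟨z, hz⟩ : ∃ z, z ∉ insert 0 (s.image fun i => -f i v / f i w) := by
        by_contra! h
        have h1 := Finset.card_le_card (fun z _ => h z : Finset.univ ⊆ _)
        have h2 := (Finset.card_insert_le (0 : k) (s.image fun i => -f i v / f i w)).trans
          (Nat.succ_le_succ Finset.card_image_le)
        rw [Finset.card_univ] at h1
        omega
      simp only [Finset.mem_insert, Finset.mem_image, not_or, not_exists, not_and] at hz
      refine ⟨v + z • w, fun i hi => ?_⟩
      rw [map_add, map_smul, smul_eq_mul]
      rcases Finset.mem_insert.1 hi with rfl | hi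
      · simpa [hav] using ⟨hz.1, hw⟩
      · intro h
        by_cases hiw : f i w = 0
        · exact hv i hi (by simpa [hiw] using h)
        · exact hz.2 i hi (by rw [div_eq_iff hiw]; linear_combination -h)
    · refine ⟨v, fun i hi => ?_⟩
      rcases Finset.mem_insert.1 hi with rfl | hi
      exacts [hav, hv i hi]

variable {K L : ℕ} {𝔽 : Type*} [Field 𝔽]

/-- The rows in `insert i S`, cut to their first `S.card + 1` columns, form an invertible matrix;
solve for a unit vector and extend the solution by zero. -/
theorem IsGeneric.exists_dotProduct_eq_zero_and_ne_zero {R : DeliveryRandomness K L 𝔽}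
    (hR : IsGeneric R) (S : Finset (Fin K)) (hS : S.card + 1 ≤ L) {i : Fin K} (hi : i ∉ S) :
    ∃ v, (∀ j ∈ S, R.channel j ⬝ᵥ v = 0) ∧ R.channel i ⬝ᵥ v ≠ 0 := by
  have hcard : (insert i S).card = S.card + 1 := Finset.card_insert_of_notMem hi
  let ρ := (insert i S).orderEmbOfFin hcard
  let A := Matrix.of fun a b => R.channel (ρ a) (Fin.castLE hS b)
  have hA : IsUnit A := (Matrix.isUnit_iff_isUnit_det _).2
    (isUnit_iff_ne_zero.2 (hR.channel_det_ne_zero hS ρ.toEmbedding))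
  have hmem (j) (hj : j ∈ insert i S) : ∃ a, ρ a = j := by
    have : j ∈ Set.range ρ := by
      rw [Finset.range_orderEmbOfFin]
      exact hj
    exact this
  obtain ⟨a, ha⟩ := hmem i (Finset.mem_insert_self _ _)
  obtain ⟨u, hu⟩ := Matrix.mulVec_surjective_iff_isUnit.2 hA (Pi.single a 1)
  have hv (b) : R.channel (ρ b) ⬝ᵥ (∑ c, u c • Pi.single (Fin.castLE hS c) 1) =
      (Pi.single a 1 : Fin (S.card + 1) → 𝔽) b := by
    rw [← hu]
    simp only [dotProduct_sum, dotProduct_smul, dotProduct_single, mul_one, smul_eq_mul]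
    exact Finset.sum_congr rfl fun c _ => mul_comm _ _
  refine ⟨∑ c, u c • Pi.single (Fin.castLE hS c) 1, fun j hj => ?_, ?_⟩
  · obtain ⟨b, hb⟩ := hmem j (Finset.mem_insert_of_mem hj)
    rw [← hb, hv, Pi.single_eq_of_ne]
    rintro rfl
    exact hi (by rw [← ha, hb]; exact hj)
  · rw [← ha, hv]
    simp

/-- This is where the choice `α + L - 1` of the group size matters: `L` transmitters can null at `L
- 1` users. -/
theorem card_sdiff_add_one_le (hL : 1 ≤ L) {α : ℕ} {T U : Finset (Fin K)}
    (hT : T.card = groupSize K L α) (hUT : U ⊆ T) (hU : U.card = α) : (T \ U).card + 1 ≤ L := by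
  rw [Finset.card_sdiff_of_subset hUT, hT, hU, groupSize]
  omega

theorem IsGeneric.exists_isBeamformer [Fintype 𝔽] (hL : 1 ≤ L) (hK : K < Fintype.card 𝔽)
    {R : DeliveryRandomness K L 𝔽} (hR : IsGeneric R) : ∃ ψ, IsBeamformer R.channel ψ := by
  -- The vector depends only on `S = T \ U`, so it is made nonzero at every user outside `S`, which
  -- covers all pairs `T`, `U` with that difference.
  have main (S : Finset (Fin K)) : ∃ v, S.card + 1 ≤ L →
      (∀ i ∈ S, R.channel i ⬝ᵥ v = 0) ∧ ∀ i ∉ S, R.channel i ⬝ᵥ v ≠ 0 := by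
    by_cases hS : S.card + 1 ≤ L
    · let E : Submodule 𝔽 (Fin L → 𝔽) :=
        ⨅ i ∈ S, LinearMap.ker (dotProductBilin 𝔽 𝔽 (R.channel i))
      have hE (v) : v ∈ E ↔ ∀ i ∈ S, R.channel i ⬝ᵥ v = 0 := by simp [E]
      obtain ⟨v, hv⟩ := exists_forall_linearMap_ne_zero
        (fun i => (dotProductBilin 𝔽 𝔽 (R.channel i)).comp E.subtype) (Finset.univ \ S)
        (((Finset.card_le_univ _).trans_eq (Fintype.card_fin K)).trans_lt hK) fun i hi h => by
          obtain ⟨w, hw, hiw⟩ :=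
            hR.exists_dotProduct_eq_zero_and_ne_zero S hS (Finset.mem_sdiff.1 hi).2
          exact hiw (LinearMap.congr_fun h ⟨w, (hE w).2 hw⟩)
      exact ⟨v, fun _ => ⟨(hE v).1 v.2, fun i hi => hv i (by simpa using hi)⟩⟩
    · exact ⟨0, fun h => absurd h hS⟩
  choose ψ hψ using main
  refine ⟨ψ, fun α _ T hT U hUT hU => ?_⟩
  have h := hψ _ (card_sdiff_add_one_le hL hT hUT hU)
  exact ⟨h.1, fun i hi => h.2 i (by simp [hi])⟩

end Beamforming

/-! ### Counting time slots and bounding the padding -/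

section Delay

variable {K L N F s m : ℕ}

theorem numPieces_pos (K L : ℕ) {α : ℕ} (hα : α ≤ K) : 0 < numPieces K L α :=
  Nat.choose_pos (by unfold groupSize; omega)

theorem X_eq_numPieces_mul_blockLength (p : Placement K N F s) (d : Fin K → Fin N) (α : ℕ)
    (τ : Finset (Fin K)) : X L m p d α τ = numPieces K L α * blockLength L m p d α τ := by
  have h {ι : Type} (t : Finset ι) (f : ι → ℕ) (c : ℕ) :
      c * t.sup f = t.sup fun i => c * f i :=
    Finset.apply_sup_eq_sup_comp (c * ·) (fun x y => Nat.mul_max_mul_left ..|>.symm) (mul_zero c)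
  simp only [X, blockLength, h]

theorem sum_Icc_one_eq_sum_fin {R : Type*} [AddCommMonoid R] (K : ℕ) (f : ℕ → R) :
    ∑ α ∈ Finset.Icc 1 K, f α = ∑ i : Fin K, f ((i : ℕ) + 1) := by
  rw [Fin.sum_univ_eq_sum_range (fun i => f (i + 1)), Finset.range_eq_Ico,
    Finset.sum_Ico_add' f 0 K 1]
  congr 1

variable {𝔽 : Type*} [Field 𝔽]

theorem deliveryTime_eq_sum (e : (Fin m → Bool) ≃ 𝔽) (p : Placement K N F s)
    (d : Fin K → Fin N) (R : DeliveryRandomness K L 𝔽) (ψ : Finset (Fin K) → Fin L → 𝔽)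
    (W : Library N F) :
    deliveryTime e p d R ψ W = ∑ α ∈ Finset.Icc 1 K,
      ∑ τ ∈ Finset.univ.powersetCard (groupSize K L α),
        numReps K L α * blockLength L m p d α τ := by
  rw [sum_Icc_one_eq_sum_fin, Fin.sum_univ_def]
  simp only [deliveryTime, transmissions, List.length_flatMap, List.map_reverse, List.sum_reverse,
    List.length_map, List.length_range, List.map_const', List.length_finRange, List.sum_replicate,
    smul_eq_mul, groups, Finset.sum_map_toList]

/-- The number of time slots used for the demands `d`, which does not depend on the channel, the
coefficients, the beamforming vectors or the content of the library. -/
def delay (L m : ℕ) (p : Placement K N F s) (d : Fin K → Fin N) : ℕ :=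
  ∑ α ∈ Finset.Icc 1 K, ∑ τ ∈ Finset.univ.powersetCard (groupSize K L α),
    numReps K L α * blockLength L m p d α τ

theorem delay_eq_sum (p : Placement K N F s) (d : Fin K → Fin N) :
    (delay L m p d : ℝ) = ∑ α ∈ Finset.Icc 1 K,
      ∑ τ ∈ Finset.univ.powersetCard (min (α + L - 1) K),
        ((min (α + L - 1) K - 1).choose (α - 1) : ℝ) /
          ((K - α).choose (min (α + L - 1) K - α) : ℝ) * (X L m p d α τ : ℝ) := by
  unfold delay
  push_cast
  refine Finset.sum_congr rfl fun α hα => Finset.sum_congr rfl fun τ _ => ?_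
  have hpos : (numPieces K L α : ℝ) ≠ 0 :=
    Nat.cast_ne_zero.2 (numPieces_pos K L (Finset.mem_Icc.1 hα).2).ne'
  rw [X_eq_numPieces_mul_blockLength, Nat.cast_mul]
  change _ = (numReps K L α : ℝ) / (numPieces K L α : ℝ) * _
  field_simp

theorem exists_forall_codingDelay_eq (hN : 0 < N) (e : (Fin m → Bool) ≃ 𝔽)
    (p : Placement K N F s) : ∃ d : Fin K → Fin N, ∀ (R : DeliveryRandomness K L 𝔽)
      (ψ : Finset (Fin K) → Fin L → 𝔽) (W : Library N F),
      codingDelay e p R ψ W = delay L m p d := by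
  have : Nonempty (Fin N) := ⟨⟨0, hN⟩⟩
  obtain ⟨d, -, hd⟩ := Finset.exists_mem_eq_sup (Finset.univ : Finset (Fin K → Fin N))
    Finset.univ_nonempty (delay L m p)
  refine ⟨d, fun R ψ W => ?_⟩
  rw [← hd, codingDelay]
  exact Finset.sup_congr rfl fun d _ => deliveryTime_eq_sum e p d R ψ W

theorem largestSubfile_le_mul_X (hm : 0 < m) (p : Placement K N F s) (d : Fin K → Fin N) {α : ℕ}
    (hα : α ≤ K) (τ : Finset (Fin K)) :
    largestSubfile p d α τ ≤ m * X L m p d α τ := by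
  refine Finset.sup_le fun U hU => Finset.sup_le fun r hr => ?_
  have hX : numPieces K L α * (pieceBits L p d U r ⌈/⌉ m) ≤ X L m p d α τ :=
    (Finset.le_sup (f := fun r => numPieces K L α * (pieceBits L p d U r ⌈/⌉ m)) hr).trans
      (Finset.le_sup (f := fun U : Finset (Fin K) => U.sup fun r =>
        numPieces K L α * (pieceBits L p d U r ⌈/⌉ m)) hU)
  have h1 : (subfile p d r (U.erase r)).card ≤ numPieces K L α * pieceBits L p d U r := by
    rw [pieceBits, (Finset.mem_powersetCard.1 hU).2]
    exact le_smul_ceilDiv (numPieces_pos K L hα)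
  have h2 : pieceBits L p d U r ≤ m * (pieceBits L p d U r ⌈/⌉ m) := le_smul_ceilDiv hm
  calc _ ≤ numPieces K L α * (m * (pieceBits L p d U r ⌈/⌉ m)) := h1.trans (by gcongr)
    _ = m * (numPieces K L α * (pieceBits L p d U r ⌈/⌉ m)) := by ring
    _ ≤ _ := by gcongr

theorem mul_ceilDiv_lt_add {a b : ℕ} (hb : 0 < b) : b * (a ⌈/⌉ b) < a + b := by
  rw [Nat.ceilDiv_eq_add_pred_div]
  have := Nat.mul_div_le (a + b - 1) b
  omega

theorem mul_X_lt_largestSubfile_add (hm : 0 < m) (p : Placement K N F s) (d : Fin K → Fin N)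
    {α : ℕ} (hα : α ≤ K) (τ : Finset (Fin K)) :
    m * X L m p d α τ < largestSubfile p d α τ + m * numPieces K L α := by
  have hb := numPieces_pos K L hα
  -- Here `q` is not the field size: it turns the strict bound into `≤`, which passes to suprema
  -- even over empty families.
  obtain ⟨q, hq⟩ : ∃ q, q + 1 = m * numPieces K L α := ⟨_, Nat.sub_add_cancel (mul_pos hm hb)⟩
  have hX : m * X L m p d α τ ≤ largestSubfile p d α τ + q := by
    rw [mul_comm, ← Nat.le_div_iff_mul_le hm]
    refine Finset.sup_le fun U hU => Finset.sup_le fun r hr => ?_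
    rw [Nat.le_div_iff_mul_le hm]
    have hle : (subfile p d r (U.erase r)).card ≤ largestSubfile p d α τ :=
      (Finset.le_sup (f := fun r => (subfile p d r (U.erase r)).card) hr).trans
        (Finset.le_sup (f := fun U : Finset (Fin K) => U.sup fun r =>
          (subfile p d r (U.erase r)).card) hU)
    have h := mul_ceilDiv_lt_add (a := (subfile p d r (U.erase r)).card) (mul_pos hm hb)
    -- Nested ceiling divisions collapse into one, so the padding is less than a single unit `m *
    -- numPieces K L α`.
    have hceil : pieceBits L p d U r ⌈/⌉ m =
        (subfile p d r (U.erase r)).card ⌈/⌉ (m * numPieces K L α) := by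
      rw [pieceBits, (Finset.mem_powersetCard.1 hU).2, mul_comm]
      refine eq_of_forall_ge_iff fun c => ?_
      rw [ceilDiv_le_iff_le_mul hm, ceilDiv_le_iff_le_mul hb,
        ceilDiv_le_iff_le_mul (mul_pos hb hm), mul_assoc]
    rw [hceil]
    calc _ = m * numPieces K L α *
          ((subfile p d r (U.erase r)).card ⌈/⌉ (m * numPieces K L α)) := by ring
      _ ≤ _ := by omega
  omega

end Delay

/-! ### Recovering the requested files -/

section Decoding

/-- Lets a receiver cut the received stream into blocks, since block lengths do not depend on the
library. -/
theorem eq_of_flatMap_eq {α β : Type*} {f g : α → List β} {l : List α}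
    (hlen : ∀ a ∈ l, (f a).length = (g a).length) (h : l.flatMap f = l.flatMap g) :
    ∀ a ∈ l, f a = g a := by
  induction l with
  | nil => simp
  | cons b l ih =>
    rw [List.flatMap_cons, List.flatMap_cons] at h
    obtain ⟨h1, h2⟩ := List.append_inj h (hlen b List.mem_cons_self)
    intro a ha
    rcases List.mem_cons.1 ha with rfl | ha
    · exact h1
    · exact ih (fun a ha => hlen a (List.mem_cons_of_mem _ ha)) h2 a ha

/-- Used for both counts of the scheme: groups containing `U` (`numPieces`), and subsets of a group
containing `k` (`numReps`, with `U = {k}`). -/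
theorem card_filter_subset_powersetCard {β : Type*} [DecidableEq β] {U B : Finset β} {n : ℕ}
    (hUB : U ⊆ B) (hU : U.card ≤ n) :
    ((B.powersetCard n).filter (U ⊆ ·)).card = (B.card - U.card).choose (n - U.card) := by
  rw [← Finset.card_sdiff_of_subset hUB, ← Finset.card_powersetCard]
  refine Finset.card_nbij' (· \ U) (· ∪ U) ?_ ?_ ?_ ?_
  · intro V hV
    simp only [Finset.coe_filter, Finset.mem_powersetCard, Set.mem_ofPred_eq] at hV
    simp only [Finset.mem_coe, Finset.mem_powersetCard]
    exact ⟨Finset.sdiff_subset_sdiff hV.1.1 subset_rfl,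
      by rw [Finset.card_sdiff_of_subset hV.2, hV.1.2]⟩
  · intro V hV
    simp only [Finset.mem_coe, Finset.mem_powersetCard] at hV
    simp only [Finset.coe_filter, Finset.mem_powersetCard, Set.mem_ofPred_eq]
    refine ⟨⟨Finset.union_subset (hV.1.trans Finset.sdiff_subset) hUB, ?_⟩,
      Finset.subset_union_right⟩
    rw [Finset.card_union_of_disjoint (Finset.sdiff_disjoint.mono_left hV.1), hV.2]
    omega
  · intro V hV
    simp only [Finset.coe_filter, Set.mem_ofPred_eq] at hV
    exact Finset.sdiff_union_of_subset hV.2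
  · intro V hV
    simp only [Finset.mem_coe, Finset.mem_powersetCard] at hV
    exact Finset.union_sdiff_cancel_right (Finset.sdiff_disjoint.mono_left hV.1)

variable {K L N F s m : ℕ}

theorem mem_groups {α : ℕ} {T : Finset (Fin K)} :
    T ∈ groups K L α ↔ T.card = groupSize K L α := by
  simp [groups]

theorem card_le_groupSize (hL : 1 ≤ L) (U : Finset (Fin K)) : U.card ≤ groupSize K L U.card := by
  have := (Finset.card_le_univ U).trans_eq (Fintype.card_fin K)
  unfold groupSize
  omega

/-- There are exactly `numPieces` groups containing `U`, so their positions in the duplicate-free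
list exhaust all indices and no mini-file is left unsent. -/
theorem exists_pieceIndex_eq (hL : 1 ≤ L) (U : Finset (Fin K)) {n : ℕ}
    (hn : n < numPieces K L U.card) :
    ∃ T, T.card = groupSize K L U.card ∧ U ⊆ T ∧ pieceIndex L U T = n := by
  let l := (groups K L U.card).filter fun T => U ⊆ T
  have hnodup : l.Nodup := (Finset.nodup_toList _).filter _
  have hlen : l.length = numPieces K L U.card := by
    rw [← List.toFinset_card_of_nodup hnodup]
    have h : l.toFinset = (Finset.univ.powersetCard (groupSize K L U.card)).filter (U ⊆ ·) := by
      ext T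
      simp [l, mem_groups]
    rw [h, card_filter_subset_powersetCard (Finset.subset_univ U) (card_le_groupSize hL U),
      Finset.card_univ, Fintype.card_fin, numPieces]
  have hn' : n < l.length := hlen ▸ hn
  have hmem : l[n] ∈ l := List.getElem_mem hn'
  simp only [l, List.mem_filter, mem_groups, decide_eq_true_eq] at hmem
  exact ⟨l[n], hmem.1, hmem.2, hnodup.idxOf_getElem n hn'⟩

theorem miniFile_congr (p : Placement K N F s) (d : Fin K → Fin N) {W W' : Library N F}
    {T U : Finset (Fin K)} {r : Fin K}
    (h : ∀ x ∈ subfile p d r (U.erase r), W (d r) x = W' (d r) x) :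
    miniFile L p d W T U r = miniFile L p d W' T U r := by
  unfold miniFile
  congr 2
  exact List.map_congr_left fun x hx => h x ((Finset.mem_sort _).1 hx)

theorem cacheContent_eq_iff (p : Placement K N F s) {W W' : Library N F} {k : Fin K} :
    cacheContent p W k = cacheContent p W' k ↔
      ∀ n, ∀ x ∈ p.cached k n, W n x = W' n x := by
  simp only [funext_iff, cacheContent]
  refine forall_congr' fun n => forall_congr' fun x => ?_
  by_cases hx : x ∈ p.cached k n <;> simp [hx]

/-- A subfile is determined by the symbols of its mini-files. -/
theorem eq_of_symbol_miniFile_eq {𝔽 : Type*} (hL : 1 ≤ L) (hm : 0 < m) (e : (Fin m → Bool) ≃ 𝔽)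
    (p : Placement K N F s) (d : Fin K → Fin N) {W W' : Library N F} {U : Finset (Fin K)}
    {r : Fin K}
    (h : ∀ T, T.card = groupSize K L U.card → U ⊆ T → ∀ j < pieceBits L p d U r ⌈/⌉ m,
      symbol e (miniFile L p d W T U r) j = symbol e (miniFile L p d W' T U r) j)
    {x : Fin F} (hx : x ∈ subfile p d r (U.erase r)) : W (d r) x = W' (d r) x := by
  let l := (subfile p d r (U.erase r)).sort (· ≤ ·)
  let B := pieceBits L p d U r
  have hUK : U.card ≤ K := (Finset.card_le_univ U).trans_eq (Fintype.card_fin K)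
  obtain ⟨a, ha, hax⟩ := List.getElem_of_mem ((Finset.mem_sort (· ≤ ·)).2 hx)
  have hlen : l.length ≤ numPieces K L U.card * B := by
    rw [Finset.length_sort]
    exact le_smul_ceilDiv (numPieces_pos K L hUK)
  have ha' : a < numPieces K L U.card * B := lt_of_lt_of_le ha hlen
  have hB : 0 < B := Nat.pos_of_ne_zero fun h0 => by simp [h0] at ha'
  obtain ⟨T, hT, hUT, hTn⟩ := exists_pieceIndex_eq hL U
    ((Nat.div_lt_iff_lt_mul hB).2 ha' : a / B < numPieces K L U.card)
  have hb : a % B < B := Nat.mod_lt _ hB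
  -- Bit number `a` of the subfile lies in mini-file `a / B` at offset `a % B`, hence in symbol `a %
  -- B / m` of that mini-file.
  have hget (V : Library N F) : (miniFile L p d V T U r).getD (a % B) false = V (d r) x := by
    have hidx : a / B * B + a % B = a := Nat.div_add_mod' a B
    have hopt : (miniFile L p d V T U r)[a % B]? = some (V (d r) x) := by
      unfold miniFile
      rw [List.getElem?_take_of_lt hb, List.getElem?_drop, hTn, hidx, List.getElem?_map,
        List.getElem?_eq_getElem ha, hax]
      rfl
    simp [hopt]
  have hj : a % B / m < B ⌈/⌉ m := by
    by_contra! hle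
    rw [ceilDiv_le_iff_le_mul hm] at hle
    exact absurd (hle.trans (Nat.mul_div_le _ _)) (by omega)
  have hs := congrFun (e.injective (h T hT hUT _ hj)) ⟨a % B % m, Nat.mod_lt _ hm⟩
  simp only [Nat.div_add_mod'] at hs
  rw [← hget W, ← hget W', hs]

variable {𝔽 : Type*} [Field 𝔽]

theorem transmission_eq_of_received_eq (e : (Fin m → Bool) ≃ 𝔽) (p : Placement K N F s)
    (d : Fin K → Fin N) (R : DeliveryRandomness K L 𝔽) (ψ : Finset (Fin K) → Fin L → 𝔽)
    {W W' : Library N F} (φ : (Fin L → 𝔽) → 𝔽)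
    (h : (transmissions e p d R ψ W).map φ = (transmissions e p d R ψ W').map φ)
    (i : Fin K) {T : Finset (Fin K)} (hT : T.card = groupSize K L ((i : ℕ) + 1))
    (ω : Fin (numReps K L ((i : ℕ) + 1))) {j : ℕ}
    (hj : j < blockLength L m p d ((i : ℕ) + 1) T) :
    φ (∑ U ∈ T.powersetCard ((i : ℕ) + 1),
        (∑ r ∈ U, R.coeff i T ω U r * symbol e (miniFile L p d W T U r) j) • ψ (T \ U)) =
      φ (∑ U ∈ T.powersetCard ((i : ℕ) + 1),
        (∑ r ∈ U, R.coeff i T ω U r * symbol e (miniFile L p d W' T U r) j) • ψ (T \ U)) := by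
  simp only [transmissions, List.map_flatMap, List.map_map] at h
  have h1 := eq_of_flatMap_eq (fun i _ => by simp [List.length_flatMap]) h i (by simp)
  have h2 := eq_of_flatMap_eq (fun T _ => by simp [List.length_flatMap]) h1 T (mem_groups.2 hT)
  have h3 := eq_of_flatMap_eq (fun ω _ => by simp) h2 ω (by simp)
  exact List.map_inj_left.1 h3 j (List.mem_range.2 hj)

/-- Over a generic channel, a user can solve the linear equations that it receives for the symbols
of the mini-files that it requests. -/
theorem symbol_eq_of_received_eq {R : DeliveryRandomness K L 𝔽} (hR : IsGeneric R)
    {ψ : Finset (Fin K) → Fin L → 𝔽} (hψ : IsBeamformer R.channel ψ) {k i : Fin K}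
    {T : Finset (Fin K)} (hT : T.card = groupSize K L ((i : ℕ) + 1)) (hk : k ∈ T)
    (y y' : Finset (Fin K) → Fin K → 𝔽) (hy : ∀ U, k ∈ U → ∀ r ∈ U, r ≠ k → y U r = y' U r)
    (h : ∀ ω, (R.channel *ᵥ ∑ U ∈ T.powersetCard ((i : ℕ) + 1),
        (∑ r ∈ U, R.coeff i T ω U r * y U r) • ψ (T \ U)) k =
      (R.channel *ᵥ ∑ U ∈ T.powersetCard ((i : ℕ) + 1),
        (∑ r ∈ U, R.coeff i T ω U r * y' U r) • ψ (T \ U)) k)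
    {U : Finset (Fin K)} (hUT : U ⊆ T) (hU : U.card = (i : ℕ) + 1) (hkU : k ∈ U) :
    y U k = y' U k := by
  let S := (T.powersetCard ((i : ℕ) + 1)).filter ({k} ⊆ ·)
  have hS (V) : V ∈ S ↔ (V ⊆ T ∧ V.card = (i : ℕ) + 1) ∧ k ∈ V := by simp [S]
  have hcard : S.card = numReps K L ((i : ℕ) + 1) := by
    rw [card_filter_subset_powersetCard (by simpa using hk) (by simp), hT, Finset.card_singleton,
      numReps]
  let ε : Fin (numReps K L ((i : ℕ) + 1)) ≃ S := (S.equivFinOfCardEq hcard).symm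
  let A := Matrix.of fun a b => R.coeff i T a (ε b).1 k
  have hA : A.det ≠ 0 :=
    hR.coeff_det_ne_zero i T k (ε.toEmbedding.trans (Function.Embedding.subtype _))
  have hbeam (V) (hVT : V ⊆ T) (hV : V.card = (i : ℕ) + 1) :=
    hψ ((i : ℕ) + 1) (Finset.mem_Icc.2 ⟨by omega, i.2⟩) T hT V hVT hV
  -- The gain `h_k · ψ` is absorbed into the unknown, so that the system matrix is the bare
  -- coefficient matrix `A`.
  let z : Finset (Fin K) → 𝔽 := fun V => (R.channel k ⬝ᵥ ψ (T \ V)) * (y V k - y' V k)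
  have hz : A *ᵥ (fun b => z (ε b).1) = 0 := by
    ext ω
    have h0 := sub_eq_zero.2 (h ω)
    rw [Matrix.mulVec, Matrix.mulVec, dotProduct_sum, dotProduct_sum, ← Finset.sum_sub_distrib,
      ← Finset.sum_subset (Finset.filter_subset ({k} ⊆ ·) _)] at h0
    · rw [Pi.zero_apply, ← h0]
      change ∑ b, R.coeff i T ω (ε b).1 k * z (ε b).1 =
        ∑ V ∈ S, (R.channel k ⬝ᵥ _ - R.channel k ⬝ᵥ _)
      rw [Equiv.sum_comp ε fun V => R.coeff i T ω V.1 k * z V.1,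
        Finset.sum_coe_sort S fun V => R.coeff i T ω V k * z V]
      refine Finset.sum_congr rfl fun V hV => ?_
      have hkV := ((hS V).1 hV).2
      rw [dotProduct_smul, dotProduct_smul, smul_eq_mul, smul_eq_mul, ← sub_mul,
        ← Finset.sum_sub_distrib, Finset.sum_eq_single_of_mem k hkV]
      · simp only [z]
        ring
      · intro r hr hrk
        rw [hy V hkV r hr hrk, sub_self]
    · intro V hV hVS
      rw [Finset.mem_powersetCard] at hV
      have hkV : k ∈ T \ V := by
        refine Finset.mem_sdiff.2 ⟨hk, fun hkV => hVS ?_⟩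
        simpa [hkV] using hV
      rw [dotProduct_smul, dotProduct_smul, (hbeam V hV.1 hV.2).1 k hkV]
      simp
  have hz0 := congrFun (Matrix.eq_zero_of_mulVec_eq_zero hA hz)
    (ε.symm ⟨U, (hS U).2 ⟨⟨hUT, hU⟩, hkU⟩⟩)
  simp only [Equiv.apply_symm_apply, Pi.zero_apply, z] at hz0
  exact sub_eq_zero.1 ((mul_eq_zero.1 hz0).resolve_left ((hbeam U hUT hU).2 k hkU))

theorem IsGeneric.decodes (hL : 1 ≤ L) (hm : 0 < m) (e : (Fin m → Bool) ≃ 𝔽)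
    {R : DeliveryRandomness K L 𝔽} (hR : IsGeneric R) {ψ : Finset (Fin K) → Fin L → 𝔽}
    (hψ : IsBeamformer R.channel ψ) (p : Placement K N F s) (d : Fin K → Fin N) (k : Fin K) :
    Decodes e p d R ψ k := by
  let obs : Library N F → List 𝔽 × (Fin N → Fin F → Option Bool) := fun W =>
    ((transmissions e p d R ψ W).map fun v => (R.channel *ᵥ v) k, cacheContent p W k)
  -- A decoder exists as soon as libraries with equal observations agree on the requested file; it
  -- is then an extension of the induced map by a junk value.
  suffices h : Function.FactorsThrough (fun W : Library N F => W (d k)) obs by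
    refine ⟨fun l c => Function.extend obs (fun W => W (d k)) (fun _ _ => false) (l, c),
      fun W => h.extend_apply _ W⟩
  intro W W' hobs
  obtain ⟨hrec, hcache⟩ := Prod.mk.inj hobs
  rw [cacheContent_eq_iff] at hcache
  funext x
  change W (d k) x = W' (d k) x
  by_cases hx : x ∈ p.cached k (d k)
  · exact hcache _ x hx
  -- The uncached bit `x` belongs to exactly one subfile, that of the users caching it; adding `k`
  -- gives the set `U` through which it is delivered.
  let U := insert k (Finset.univ.filter fun k' => x ∈ p.cached k' (d k))
  have hkU : k ∈ U := Finset.mem_insert_self _ _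
  have hxU : x ∈ subfile p d k (U.erase k) := by
    simp [U, subfile, hx]
  have hUcard : U.card ≤ K := (Finset.card_le_univ U).trans_eq (Fintype.card_fin K)
  have hUpos : 0 < U.card := Finset.card_pos.2 ⟨k, hkU⟩
  let i : Fin K := ⟨U.card - 1, by omega⟩
  have hi : (i : ℕ) + 1 = U.card := Nat.sub_add_cancel hUpos
  refine eq_of_symbol_miniFile_eq hL hm e p d (fun T hT hUT j hj => ?_) hxU
  rw [← hi] at hT
  refine symbol_eq_of_received_eq hR hψ hT (hUT hkU)
    (fun V r => symbol e (miniFile L p d W T V r) j)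
    (fun V r => symbol e (miniFile L p d W' T V r) j) (fun V hkV r hr hrk => ?_) (fun ω => ?_)
    hUT hi.symm hkU
  · refine congrArg (symbol e · j) (miniFile_congr p d fun y hy => hcache _ y ?_)
    simp only [subfile, Finset.mem_filter, Finset.mem_univ, true_and] at hy
    exact (hy k).2 (Finset.mem_erase.2 ⟨hrk.symm, hkV⟩)
  · refine transmission_eq_of_received_eq e p d R ψ (fun v => (R.channel *ᵥ v) k) hrec i hT ω
      (hj.trans_le ?_)
    exact (Finset.le_sup (f := fun r => pieceBits L p d U r ⌈/⌉ m) hkU).trans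
      (Finset.le_sup (f := fun U : Finset (Fin K) => U.sup fun r => pieceBits L p d U r ⌈/⌉ m)
        (Finset.mem_powersetCard.2 ⟨hUT, hi.symm⟩))

end Decoding

/-! ### Assembling the probability bound -/

section Main

variable {K N F s : ℕ}

instance : Finite (Placement K N F s) :=
  Finite.of_injective Placement.cached fun _ _ h => Placement.ext h

theorem nonempty_placement (h : s ≤ F) : Nonempty (Placement K N F s) := by
  obtain ⟨t, -, ht⟩ := Finset.exists_subset_card_eq
    (h.trans_eq (Finset.card_fin F).symm : s ≤ (Finset.univ : Finset (Fin F)).card)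
  exact ⟨⟨fun _ _ => t, fun _ _ => ht⟩⟩

open MeasureTheory ProbabilityTheory in
/-- With high probability over a large field, beamforming vectors exist and all users decode. -/
theorem one_sub_le_uniformOn_real_decodes {L m : ℕ} {𝔽 : Type*} [Field 𝔽] [Fintype 𝔽]
    (hL : 1 ≤ L) (hm : 0 < m) (e : (Fin m → Bool) ≃ 𝔽) (N F s : ℕ) :
    1 - (∑ x : MinorIndex K L, (x.size : ℝ) + K) / Fintype.card 𝔽 ≤
      (uniformOn (Set.univ : Set (DeliveryRandomness K L 𝔽))).real
        {R | (∃ ψ, IsBeamformer R.channel ψ) ∧ ∀ ψ, IsBeamformer R.channel ψ →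
          ∀ (p : Placement K N F s) (d : Fin K → Fin N) (k : Fin K), Decodes e p d R ψ k} := by
  have hsum : 0 ≤ ∑ x : MinorIndex K L, (x.size : ℝ) :=
    Finset.sum_nonneg fun _ _ => Nat.cast_nonneg _
  have hq : (0 : ℝ) < Fintype.card 𝔽 := Nat.cast_pos.2 Fintype.card_pos
  -- Beamforming needs `K < q`. For `q ≤ K` the extra `K` in the constant makes the lower bound
  -- nonpositive.
  rcases lt_or_ge K (Fintype.card 𝔽) with hK | hK
  · calc _ ≤ 1 - (∑ x : MinorIndex K L, (x.size : ℝ)) / Fintype.card 𝔽 := by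
          gcongr
          exact le_add_of_nonneg_right (Nat.cast_nonneg K)
      _ ≤ _ := one_sub_le_uniformOn_real_isGeneric
      _ ≤ _ := by
          refine measureReal_mono fun R (hR : IsGeneric R) => ?_
          exact ⟨hR.exists_isBeamformer hL hK, fun ψ hψ p d k => hR.decodes hL hm e hψ p d k⟩
  · refine le_trans (sub_nonpos.2 ?_) measureReal_nonneg
    rw [one_le_div hq]
    have : (Fintype.card 𝔽 : ℝ) ≤ K := Nat.cast_le.2 hK
    linarith

end Main

end CodedCaching

theorem theorem1 (K L : ℕ) (hL : 1 ≤ L) :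
    ∃ C : ℝ, ∀ (N F m s : ℕ) (M : ℝ) (𝔽 : Type*) [Field 𝔽] (e : (Fin m → Bool) ≃ 𝔽),
      0 < N → 0 ≤ M → M ≤ N → (s : ℝ) = M / N * F →
      -- the random placement is well defined
      MeasureTheory.IsProbabilityMeasure
        (ProbabilityTheory.uniformOn (Set.univ : Set (CodedCaching.Placement K N F s))) ∧
      -- over a large field, with high probability every user is served
      1 - C / 2 ^ m ≤
        (ProbabilityTheory.uniformOn
          (Set.univ : Set (CodedCaching.DeliveryRandomness K L 𝔽))).real
          {R | (∃ ψ, CodedCaching.IsBeamformer R.channel ψ) ∧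
            ∀ ψ, CodedCaching.IsBeamformer R.channel ψ →
              ∀ (p : CodedCaching.Placement K N F s) (d : Fin K → Fin N) (k : Fin K),
                CodedCaching.Decodes e p d R ψ k} ∧
      -- the delay for given demands, and the coding delay
      (∀ p : CodedCaching.Placement K N F s,
        (∀ (d : Fin K → Fin N) (R : CodedCaching.DeliveryRandomness K L 𝔽)
          (ψ : Finset (Fin K) → Fin L → 𝔽) (W : CodedCaching.Library N F),
          (CodedCaching.deliveryTime e p d R ψ W : ℝ) =
            ∑ α ∈ Finset.Icc 1 K, ∑ τ ∈ Finset.univ.powersetCard (min (α + L - 1) K),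
              ((min (α + L - 1) K - 1).choose (α - 1) : ℝ) /
                ((K - α).choose (min (α + L - 1) K - α) : ℝ) *
                (CodedCaching.X L m p d α τ : ℝ)) ∧
        ∃ d : Fin K → Fin N, ∀ (R : CodedCaching.DeliveryRandomness K L 𝔽)
          (ψ : Finset (Fin K) → Fin L → 𝔽) (W : CodedCaching.Library N F),
          (CodedCaching.codingDelay e p R ψ W : ℝ) =
            ∑ α ∈ Finset.Icc 1 K, ∑ τ ∈ Finset.univ.powersetCard (min (α + L - 1) K),
              ((min (α + L - 1) K - 1).choose (α - 1) : ℝ) /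
                ((K - α).choose (min (α + L - 1) K - α) : ℝ) *
                (CodedCaching.X L m p d α τ : ℝ)) ∧
      -- up to the padding, `X` is the size of the largest subfile, in symbols of `m` bits
      (∀ (p : CodedCaching.Placement K N F s) (d : Fin K → Fin N), ∀ α ∈ Finset.Icc 1 K,
        ∀ τ ∈ (Finset.univ : Finset (Fin K)).powersetCard (min (α + L - 1) K),
          CodedCaching.largestSubfile p d α τ ≤ m * CodedCaching.X L m p d α τ ∧
          m * CodedCaching.X L m p d α τ <
            CodedCaching.largestSubfile p d α τ +
              m * (K - α).choose (min (α + L - 1) K - α)) := by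
  refine ⟨∑ x : CodedCaching.MinorIndex K L, (x.size : ℝ) + K, ?_⟩
  intro N F m s M 𝔽 _ e hN _ hMN hs
  have : Fintype 𝔽 := Fintype.ofEquiv _ e
  have hcard : Fintype.card 𝔽 = 2 ^ m := by
    rw [← Fintype.card_congr e]
    simp
  -- Positivity of `m` is forced: a field has at least two elements.
  have hm : 0 < m := by
    have := Fintype.one_lt_card (α := 𝔽)
    rw [hcard] at this
    exact Nat.pos_of_ne_zero fun h => by simp [h] at this
  have hsF : s ≤ F := by
    have hdiv : M / N ≤ 1 := div_le_one_of_le₀ hMN (Nat.cast_nonneg N)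
    have : (s : ℝ) ≤ F := hs.le.trans (mul_le_of_le_one_left (Nat.cast_nonneg F) hdiv)
    exact_mod_cast this
  refine ⟨?_, ?_, fun p => ⟨fun d R ψ W => ?_, ?_⟩, fun p d α hα τ _ => ⟨?_, ?_⟩⟩
  · obtain ⟨p⟩ := CodedCaching.nonempty_placement (K := K) (N := N) hsF
    exact ProbabilityTheory.isProbabilityMeasure_uniformOn Set.finite_univ ⟨p, Set.mem_univ _⟩
  · have h := CodedCaching.one_sub_le_uniformOn_real_decodes (K := K) hL hm e N F s
    rw [hcard] at h
    exact_mod_cast h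
  · rw [← CodedCaching.delay_eq_sum, CodedCaching.deliveryTime_eq_sum]
    rfl
  · obtain ⟨d, hd⟩ := CodedCaching.exists_forall_codingDelay_eq hN e p
    exact ⟨d, fun R ψ W => by rw [hd, CodedCaching.delay_eq_sum]⟩
  · exact CodedCaching.largestSubfile_le_mul_X hm p d (Finset.mem_Icc.1 hα).2 τ
  · exact CodedCaching.mul_X_lt_largestSubfile_add hm p d (Finset.mem_Icc.1 hα).2 τ
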